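/- Let $\gamma$ be an element of $\mathbb F_9$ with $\gamma^2=\gamma+1$. Let $\mathbb P(1,1,1,2)$ denote the weighted projective space with coordinates $x,y,z$ of weight $1$ and $w$ of weight $2$. Consider the surfaces in $\mathbb P(1,1,1,2)$ $$X_1\colon\ -w^2=(x^2+y^2)^2+y^3z-yz^3 \quad\text{over } \mathbb F_3,$$ $$X_2\colon\ -w^2=x^4+y^3z-yz^3 \quad\text{over } \mathbb F_3,$$ $$X_3\colon\ \gamma w^2=x^4+y^4+z^4 \quad\text{over } \mathbb F_9.$$ Then each $X_i$ is unirational over its field of definition $k_i$ (where $k_1=k_2=\mathbb F_3$ and $k_3=\mathbb F_9$); that is, there exists a dominant rational map $\mathbb P^2_{k_i}\dashrightarrow X_i$ defined over $k_i$. -/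

import Mathlib

open AlgebraicGeometry CategoryTheory MvPolynomial

noncomputable section

namespace DelPezzoTwo

universe u

section Graded

variable {k A : Type u} [CommRing k] [CommRing A] [Algebra k A]
  (𝒜 : ℕ → Submodule k A) [GradedAlgebra 𝒜] (I : HomogeneousIdeal 𝒜)

/-- The grading that a graded `k`-algebra `A` induces on its quotient by a homogeneous ideal:
the degree `i` part of `A ⧸ I` is the image of the degree `i` part of `A`. -/
def quotientGrading (i : ℕ) : Submodule k (A ⧸ I.toIdeal) :=
  (𝒜 i).map (Ideal.Quotient.mkₐ k I.toIdeal).toLinearMap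

instance quotientGrading_gradedMonoid : SetLike.GradedMonoid (quotientGrading 𝒜 I) where
  one_mem := ⟨1, SetLike.one_mem_graded 𝒜, map_one (Ideal.Quotient.mkₐ k I.toIdeal)⟩
  mul_mem := by
    rintro i j _ _ ⟨a, ha, rfl⟩ ⟨b, hb, rfl⟩
    exact ⟨a * b, SetLike.mul_mem_graded ha hb, map_mul (Ideal.Quotient.mkₐ k I.toIdeal) a b⟩

/-- Decompose in `A`, then reduce each component modulo `I`. -/
def quotientDecomposeAux : A →ₗ[k] DirectSum ℕ fun i => quotientGrading 𝒜 I i :=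
  (DirectSum.lmap fun i =>
      (Ideal.Quotient.mkₐ k I.toIdeal).toLinearMap.submoduleMap (𝒜 i)) ∘ₗ
    (DirectSum.decomposeLinearEquiv 𝒜).toLinearMap

theorem quotientDecomposeAux_apply (a : A) (i : ℕ) :
    ((quotientDecomposeAux 𝒜 I a i : quotientGrading 𝒜 I i) : A ⧸ I.toIdeal) =
      Ideal.Quotient.mk I.toIdeal (DirectSum.decompose 𝒜 a i : A) := by
  rfl

theorem quotientDecomposeAux_eq_zero (a : A) (ha : a ∈ I.toIdeal) :
    quotientDecomposeAux 𝒜 I a = 0 := by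
  refine DFinsupp.ext fun i => Subtype.ext ?_
  rw [quotientDecomposeAux_apply, Ideal.Quotient.eq_zero_iff_mem.mpr (I.isHomogeneous i ha)]
  rfl

theorem coe_quotientDecomposeAux (a : A) :
    DirectSum.coeAddMonoidHom (quotientGrading 𝒜 I) (quotientDecomposeAux 𝒜 I a) =
      Ideal.Quotient.mk I.toIdeal a := by
  induction a using DirectSum.Decomposition.inductionOn 𝒜 with
  | zero => simp
  | @homogeneous i m =>
    have : quotientDecomposeAux 𝒜 I (m : A) = DirectSum.of (fun i => quotientGrading 𝒜 I i) i
        ⟨Ideal.Quotient.mk I.toIdeal (m : A), (m : A), m.2, rfl⟩ := by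
      simp only [quotientDecomposeAux, LinearMap.comp_apply, LinearEquiv.coe_coe,
        DirectSum.decomposeLinearEquiv_apply, DirectSum.decompose_coe]
      exact DirectSum.lmap_lof _ _ _
    rw [this, DirectSum.coeAddMonoidHom_of]
  | add m m' h h' => rw [map_add, map_add, h, h', map_add]

theorem quotientDecomposeAux_surjective :
    Function.Surjective (quotientDecomposeAux 𝒜 I) := by
  refine Function.Surjective.comp (g := DirectSum.lmap fun i =>
      (Ideal.Quotient.mkₐ k I.toIdeal).toLinearMap.submoduleMap (𝒜 i))
    ((DirectSum.lmap_surjective _).mpr fun i => ?_)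
    (DirectSum.decomposeLinearEquiv 𝒜).surjective
  exact LinearMap.submoduleMap_surjective _ _

instance quotientGrading_gradedAlgebra : GradedAlgebra (quotientGrading 𝒜 I) where
  toGradedMonoid := quotientGrading_gradedMonoid 𝒜 I
  decompose' q := quotientDecomposeAux 𝒜 I (Quotient.out q)
  left_inv q := (coe_quotientDecomposeAux 𝒜 I _).trans (Quotient.out_eq q)
  right_inv x := by
    obtain ⟨a, rfl⟩ := quotientDecomposeAux_surjective 𝒜 I x
    rw [coe_quotientDecomposeAux]
    refine sub_eq_zero.mp ((map_sub (quotientDecomposeAux 𝒜 I) _ a).symm.trans ?_)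
    exact quotientDecomposeAux_eq_zero 𝒜 I _ (Ideal.Quotient.eq.mp (Quotient.out_eq _))

/-- The structure morphism `Proj 𝒜 ⟶ Spec k` for a graded `k`-algebra. -/
def projStructure : Proj 𝒜 ⟶ Spec (.of k) :=
  Proj.toSpecZero 𝒜 ≫ Spec.map (CommRingCat.ofHom (algebraMap k (𝒜 0)))

end Graded

instance standardGradedAlgebra (n : ℕ) (k : Type u) [Field k] :
    GradedAlgebra (homogeneousSubmodule (Fin (n + 1)) k) :=
  MvPolynomial.gradedAlgebra

/-- Projective `n`-space over `k`. -/
def ProjectiveSpace (n : ℕ) (k : Type u) [Field k] : Scheme.{u} :=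
  Proj (homogeneousSubmodule (Fin (n + 1)) k)

instance projectiveSpaceOver (n : ℕ) (k : Type u) [Field k] :
    (ProjectiveSpace n k).Over (Spec (.of k)) where
  hom := projStructure (homogeneousSubmodule (Fin (n + 1)) k)

/-- A `k`-variety `X` of dimension `n` is unirational if there is a dominant rational map
from projective `n`-space over `k` to `X`, defined over `k`. -/
def IsUnirational (k : Type u) [Field k] (n : ℕ) (X : Scheme.{u}) [X.Over (Spec (.of k))] : Prop :=
  ∃ f : ProjectiveSpace n k ⤏ X, f.IsOver (Spec (.of k)) ∧ f.IsDominant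

/-- The weights of the coordinates `x, y, z, w` (in this order) of `ℙ(1,1,1,2)`. -/
def wt : Fin 4 → ℕ := ![1, 1, 1, 2]

instance weightedGrading (k : Type u) [Field k] :
    GradedAlgebra (weightedHomogeneousSubmodule k wt) :=
  weightedGradedAlgebra k wt

section Surface

variable {k : Type u} [Field k]

/-- The homogeneous ideal generated by a weighted homogeneous polynomial of degree four. -/
def quarticIdeal (F : MvPolynomial (Fin 4) k) (hF : F.IsWeightedHomogeneous wt 4) :
    HomogeneousIdeal (weightedHomogeneousSubmodule k wt) :=
  ⟨Ideal.span {F}, Ideal.homogeneous_span _ _ fun _ h => ⟨4, by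
    rw [Set.mem_singleton_iff.mp h]; exact hF⟩⟩

/-- The surface `F = 0` in the weighted projective space `ℙ(1,1,1,2)` over `k`, for `F` weighted
homogeneous of degree four, as the `Proj` of its homogeneous coordinate ring. -/
def QuarticSurface (F : MvPolynomial (Fin 4) k) (hF : F.IsWeightedHomogeneous wt 4) : Scheme.{u} :=
  Proj (quotientGrading (weightedHomogeneousSubmodule k wt) (quarticIdeal F hF))

instance quarticSurfaceOver (F : MvPolynomial (Fin 4) k) (hF : F.IsWeightedHomogeneous wt 4) :
    (QuarticSurface F hF).Over (Spec (.of k)) where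
  hom := projStructure (quotientGrading (weightedHomogeneousSubmodule k wt) (quarticIdeal F hF))

end Surface

/-- `-w² - ((x² + y²)² + y³z - yz³)` over `𝔽₃`, where `x, y, z, w = X 0, X 1, X 2, X 3`. -/
def F₁ : MvPolynomial (Fin 4) (ZMod 3) :=
  -X 3 ^ 2 - ((X 0 ^ 2 + X 1 ^ 2) ^ 2 + X 1 ^ 3 * X 2 - X 1 * X 2 ^ 3)

/-- `-w² - (x⁴ + y³z - yz³)` over `𝔽₃`. -/
def F₂ : MvPolynomial (Fin 4) (ZMod 3) :=
  -X 3 ^ 2 - (X 0 ^ 4 + X 1 ^ 3 * X 2 - X 1 * X 2 ^ 3)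

/-- `γw² - (x⁴ + y⁴ + z⁴)` over `𝔽₉`. -/
def F₃ (γ : GaloisField 3 2) : MvPolynomial (Fin 4) (GaloisField 3 2) :=
  C γ * X 3 ^ 2 - (X 0 ^ 4 + X 1 ^ 4 + X 2 ^ 4)

theorem isWeightedHomogeneous_X_pow {k : Type u} [Field k] (i : Fin 4) (d n : ℕ) (h : d * wt i = n) :
    (X i ^ d : MvPolynomial (Fin 4) k).IsWeightedHomogeneous wt n := by
  subst h
  simpa using (isWeightedHomogeneous_X k wt i).pow d

theorem isWeightedHomogeneous_sub {k : Type u} [Field k] {n : ℕ} {p q : MvPolynomial (Fin 4) k}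
    (hp : p.IsWeightedHomogeneous wt n) (hq : q.IsWeightedHomogeneous wt n) :
    (p - q).IsWeightedHomogeneous wt n :=
  (weightedHomogeneousSubmodule k wt n).sub_mem hp hq

theorem isWeightedHomogeneous_neg {k : Type u} [Field k] {n : ℕ} {p : MvPolynomial (Fin 4) k}
    (hp : p.IsWeightedHomogeneous wt n) : (-p).IsWeightedHomogeneous wt n :=
  (weightedHomogeneousSubmodule k wt n).neg_mem hp

theorem F₁_homogeneous : F₁.IsWeightedHomogeneous wt 4 := by
  have h1 : (X 1 : MvPolynomial (Fin 4) (ZMod 3)).IsWeightedHomogeneous wt 1 :=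
    isWeightedHomogeneous_X _ wt 1
  have h2 : (X 2 : MvPolynomial (Fin 4) (ZMod 3)).IsWeightedHomogeneous wt 1 :=
    isWeightedHomogeneous_X _ wt 2
  exact isWeightedHomogeneous_sub (isWeightedHomogeneous_neg (isWeightedHomogeneous_X_pow 3 2 4 rfl)) (isWeightedHomogeneous_sub
    ((((isWeightedHomogeneous_X_pow 0 2 2 rfl).add (isWeightedHomogeneous_X_pow 1 2 2 rfl)).pow 2).add ((isWeightedHomogeneous_X_pow 1 3 3 rfl).mul h2))
    (h1.mul (isWeightedHomogeneous_X_pow 2 3 3 rfl)))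

theorem F₂_homogeneous : F₂.IsWeightedHomogeneous wt 4 := by
  have h1 : (X 1 : MvPolynomial (Fin 4) (ZMod 3)).IsWeightedHomogeneous wt 1 :=
    isWeightedHomogeneous_X _ wt 1
  have h2 : (X 2 : MvPolynomial (Fin 4) (ZMod 3)).IsWeightedHomogeneous wt 1 :=
    isWeightedHomogeneous_X _ wt 2
  exact isWeightedHomogeneous_sub (isWeightedHomogeneous_neg (isWeightedHomogeneous_X_pow 3 2 4 rfl)) (isWeightedHomogeneous_sub
    ((isWeightedHomogeneous_X_pow 0 4 4 rfl).add ((isWeightedHomogeneous_X_pow 1 3 3 rfl).mul h2)) (h1.mul (isWeightedHomogeneous_X_pow 2 3 3 rfl)))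

theorem F₃_homogeneous (γ : GaloisField 3 2) : (F₃ γ).IsWeightedHomogeneous wt 4 := by
  have h : (C γ * X 3 ^ 2 : MvPolynomial (Fin 4) (GaloisField 3 2)).IsWeightedHomogeneous wt
      (0 + 4) := (isWeightedHomogeneous_C wt γ).mul (isWeightedHomogeneous_X_pow 3 2 4 rfl)
  exact isWeightedHomogeneous_sub h (((isWeightedHomogeneous_X_pow 0 4 4 rfl).add (isWeightedHomogeneous_X_pow 1 4 4 rfl)).add (isWeightedHomogeneous_X_pow 2 4 4 rfl))

/-- `X₁ : -w² = (x² + y²)² + y³z - yz³` in `ℙ(1,1,1,2)` over `𝔽₃`. -/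
abbrev X₁ : Scheme := QuarticSurface F₁ F₁_homogeneous

/-- `X₂ : -w² = x⁴ + y³z - yz³` in `ℙ(1,1,1,2)` over `𝔽₃`. -/
abbrev X₂ : Scheme := QuarticSurface F₂ F₂_homogeneous

/-- `X₃ : γw² = x⁴ + y⁴ + z⁴` in `ℙ(1,1,1,2)` over `𝔽₉`. -/
abbrev X₃ (γ : GaloisField 3 2) : Scheme := QuarticSurface (F₃ γ) (F₃_homogeneous γ)

end DelPezzoTwo

end

noncomputable section

namespace DelPezzoTwo

universe u

/-! Each surface is a double plane c w² = H(x, y, z) that carries an explicit rational curve with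
parameter t. Through each point P of the curve runs a pencil of lines with parameter u. On a general
such line the second order Taylor polynomial of w = √(H/c) at P meets the surface in one further
point. Being a residual intersection, this point is rational in t and u, so it gives a rational map
from the (t, u)-plane to the surface.

Dominance is checked algebraically: it suffices that a homogeneous element of the coordinate ring
vanishing on the family is zero (`isUnirational_proj`). As c is a nonsquare and H is monic in x,
this reduces to x, y, z satisfying no homogeneous relation on the family
(`mem_span_of_aeval_eq_zero`).

To exclude such relations, everything is degenerated to t = 0. There the curve meets the
ramification locus over a hyperflex of H = 0, and the lines tend to the hyperflex tangent. In
suitable plane coordinates the new point then has initial forms tᵃu³, tᵇ, tᶜ with b ≠ c, up to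
scalars. Distinct monomials in these differ in total degree, t-exponent or u-exponent
(`algebraicIndependent_of_initial`). -/

/-! ### Dominant rational maps into `Proj`. -/

/-- A nonempty open subset of `Proj` of a domain is dense. -/
theorem dense_opens_proj {σ : Type*} {A : Type u} [CommRing A] [IsDomain A] [SetLike σ A]
    [AddSubgroupClass σ A] (𝒜 : ℕ → σ) [GradedRing 𝒜] (U : (Proj 𝒜).Opens)
    (hU : (U : Set (Proj 𝒜)).Nonempty) : Dense (U : Set (Proj 𝒜)) := by
  rw [dense_iff_inter_open]
  rintro V hV ⟨x, hx⟩
  obtain ⟨y, hy⟩ := hU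
  obtain ⟨_, ⟨r, rfl⟩, hxr, hrV⟩ :=
    (ProjectiveSpectrum.isTopologicalBasis_basic_opens 𝒜).exists_subset_of_mem_open hx hV
  obtain ⟨_, ⟨s, rfl⟩, hys, hsU⟩ :=
    (ProjectiveSpectrum.isTopologicalBasis_basic_opens 𝒜).exists_subset_of_mem_open hy U.2
  -- The generic point: the zero ideal is relevant because the smaller-than-`x` ideal `⊥` cannot
  -- contain the irrelevant ideal when `x` does not. It lies in every basic open of a nonzero
  -- element.
  let η : ProjectiveSpectrum 𝒜 := ⟨⊥, by
      rw [HomogeneousIdeal.toIdeal_bot]; exact Ideal.isPrime_bot, fun h =>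
      x.not_irrelevant_le (h.trans bot_le)⟩
  have hη : ∀ a : A, a ≠ 0 → η ∈ ProjectiveSpectrum.basicOpen 𝒜 a := fun a ha h => ha h
  refine ⟨η, hrV (hη r ?_), hsU (hη s ?_)⟩
  · rintro rfl; exact hxr (zero_mem _)
  · rintro rfl; exact hys (zero_mem _)

/-- A dominant morphism over `k` from an open subscheme of projective space shows that its target
is unirational. -/
theorem IsUnirational.of_isOpenImmersion {k : Type u} [Field k] {n : ℕ} {V X : Scheme.{u}}
    [X.Over (Spec (.of k))] [Nonempty V] (j : V ⟶ ProjectiveSpace n k) [IsOpenImmersion j]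
    (f : V ⟶ X) [IsDominant f]
    (h : f ≫ (X ↘ Spec (.of k)) = j ≫ (ProjectiveSpace n k ↘ Spec (.of k))) :
    IsUnirational k n X := by
  let g : (ProjectiveSpace n k).PartialMap X :=
    { domain := j.opensRange
      dense_domain := dense_opens_proj (homogeneousSubmodule (Fin (n + 1)) k) _
        (Set.range_nonempty j)
      hom := j.isoOpensRange.inv ≫ f }
  have hg : g.IsOver (Spec (.of k)) := by
    rw [Scheme.PartialMap.isOver_iff]
    change (j.isoOpensRange.inv ≫ f) ≫ _ = j.opensRange.ι ≫ _
    rw [Category.assoc, h, Iso.inv_comp_eq, Scheme.Hom.isoOpensRange_hom_ι_assoc]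
  have hd : IsDominant g.hom := by
    change IsDominant (j.isoOpensRange.inv ≫ f)
    infer_instance
  exact ⟨g.toRationalMap, inferInstance, inferInstance⟩

/-! ### The affine chart of the projective plane. -/

section PlaneChart

variable (k : Type u) [Field k]

theorem X_mem_homogeneousSubmodule (i : Fin 3) :
    (X i : MvPolynomial (Fin 3) k) ∈ homogeneousSubmodule (Fin 3) k 1 :=
  isHomogeneous_X k i

/-- The affine coordinate ring of the chart `T₀ ≠ 0` of the projective plane. -/
abbrev PlaneChart : Type u :=
  HomogeneousLocalization.Away (homogeneousSubmodule (Fin 3) k) (X 0)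

instance : IsDomain (PlaneChart k) := by
  have : IsDomain (Localization.Away (X 0 : MvPolynomial (Fin 3) k)) :=
    IsLocalization.isDomain_localization
      (powers_le_nonZeroDivisors_of_noZeroDivisors (X_ne_zero _))
  exact Function.Injective.isDomain
    (algebraMap (PlaneChart k) (Localization.Away (X 0 : MvPolynomial (Fin 3) k)))
    (HomogeneousLocalization.val_injective _)

/-- The constants of the chart `T₀ ≠ 0`. -/
def planeConst : k →+* PlaneChart k :=
  (HomogeneousLocalization.fromZeroRingHom (homogeneousSubmodule (Fin 3) k) _).comp
    (algebraMap k (homogeneousSubmodule (Fin 3) k 0))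

/-- The affine coordinates `T₁ / T₀` and `T₂ / T₀` on the chart `T₀ ≠ 0`. -/
def planeCoord (i : Fin 2) : PlaneChart k :=
  HomogeneousLocalization.Away.mk (homogeneousSubmodule (Fin 3) k)
    (X_mem_homogeneousSubmodule k 0) 1 (X i.succ) (X_mem_homogeneousSubmodule k i.succ)

/-- Polynomials in two variables as functions on the chart `T₀ ≠ 0`. -/
def planeChartMap : MvPolynomial (Fin 2) k →+* PlaneChart k :=
  eval₂Hom (planeConst k) (planeCoord k)

/-- Dehomogenization T₀ ↦ 1 provides a left inverse. Surjectivity is not needed for dominance. -/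
theorem planeChartMap_injective : Function.Injective (planeChartMap k) := by
  let δ : MvPolynomial (Fin 3) k →ₐ[k] MvPolynomial (Fin 2) k := aeval (Fin.cons 1 X)
  have hδ : IsUnit (δ (X 0)) := by simp [δ]
  let ρ : PlaneChart k →+* MvPolynomial (Fin 2) k :=
    (Localization.awayLift δ.toRingHom (X 0) hδ).comp (algebraMap _ _)
  have h : ρ.comp (planeChartMap k) = RingHom.id _ := by
    refine MvPolynomial.ringHom_ext (fun r => ?_) fun i => ?_
    · simp only [ρ, planeChartMap, planeConst, RingHom.comp_apply, coe_eval₂Hom, eval₂_C,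
        HomogeneousLocalization.algebraMap_apply]
      change Localization.awayLift δ.toRingHom (X 0) hδ (Localization.mk (C r) 1) = _
      rw [Localization.mk_one_eq_algebraMap, IsLocalization.Away.lift_eq]
      simp [δ]
    · simp only [ρ, planeChartMap, planeCoord, RingHom.comp_apply, coe_eval₂Hom, eval₂_X,
        HomogeneousLocalization.algebraMap_apply, HomogeneousLocalization.Away.val_mk]
      rw [Localization.mk_eq_mk', Localization.awayLift, IsLocalization.Away.lift,
        IsLocalization.lift_mk'_spec]
      simp [δ]
  exact Function.LeftInverse.injective (g := ρ) fun p => congrArg (fun f => f p) h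

/-- The inclusion of the chart `T₀ ≠ 0` into the projective plane. -/
def planeChartι : Spec (.of (PlaneChart k)) ⟶ ProjectiveSpace 2 k :=
  Proj.awayι (homogeneousSubmodule (Fin 3) k) (X 0) (X_mem_homogeneousSubmodule k 0) one_pos

instance : IsOpenImmersion (planeChartι k) :=
  inferInstanceAs (IsOpenImmersion (Proj.awayι (homogeneousSubmodule (Fin 3) k) (X 0)
    (X_mem_homogeneousSubmodule k 0) one_pos))

theorem planeChartι_over : planeChartι k ≫ (ProjectiveSpace 2 k ↘ Spec (.of k)) =
    Spec.map (CommRingCat.ofHom (planeConst k)) := by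
  change Proj.awayι (homogeneousSubmodule (Fin 3) k) (X 0) (X_mem_homogeneousSubmodule k 0)
    one_pos ≫ Proj.toSpecZero (homogeneousSubmodule (Fin 3) k) ≫ _ = _
  rw [Proj.awayι_toSpecZero_assoc, ← Spec.map_comp]
  rfl

end PlaneChart

/-! ### Unirationality from a map of the coordinate ring to k[t, u]. -/

/-- `Proj` of a graded `k`-algebra that maps to `k[t, u]`, injectively on homogeneous elements,
is unirational. -/
theorem isUnirational_proj {k A : Type u} [Field k] [CommRing A] [Algebra k A]
    (𝒜 : ℕ → Submodule k A) [GradedAlgebra 𝒜] (φ : A →ₐ[k] MvPolynomial (Fin 2) k)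
    {d : ℕ} (hd : 0 < d) {a : A} (ha : a ∈ 𝒜 d) (hφa : φ a ≠ 0)
    (hφ : ∀ n, ∀ b ∈ 𝒜 n, φ b = 0 → b = 0) :
    @IsUnirational k _ 2 (Proj 𝒜) ⟨projStructure 𝒜⟩ := by
  classical
  let _ : (Proj 𝒜).Over (Spec (.of k)) := ⟨projStructure 𝒜⟩
  set z : PlaneChart k := planeChartMap k (φ a) with hz
  have hz0 : z ≠ 0 := fun h => hφa (planeChartMap_injective k (h.trans (map_zero _).symm))
  have hdom : IsDomain (Localization.Away z) :=
    IsLocalization.isDomain_localization (powers_le_nonZeroDivisors_of_noZeroDivisors hz0)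
  let B : CommRingCat.{u} := .of (Localization.Away z)
  let ι : PlaneChart k →+* Localization.Away z := algebraMap _ _
  have hι : Function.Injective ι :=
    IsLocalization.injective _ (powers_le_nonZeroDivisors_of_noZeroDivisors hz0)
  let ψ₀ : A →+* Localization.Away z := (ι.comp (planeChartMap k)).comp φ.toRingHom
  let ψ : A →+* Γ(Spec B, ⊤) := (Scheme.ΓSpecIso B).inv.hom.comp ψ₀
  have hψ : ∀ n, ∀ b ∈ 𝒜 n, ψ b = 0 → b = 0 := fun n b hb h => by
    refine hφ n b hb (planeChartMap_injective k (hι ?_))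
    have := congrArg (Scheme.ΓSpecIso B).hom.hom h
    simpa [ψ, ψ₀] using this
  have hunit : IsUnit (ψ a) := by
    have : IsUnit (ψ₀ a) := IsLocalization.Away.algebraMap_isUnit (S := Localization.Away z) z
    exact this.map (Scheme.ΓSpecIso B).inv.hom
  have hirr : (HomogeneousIdeal.irrelevant 𝒜).toIdeal.map ψ = ⊤ := by
    refine Ideal.eq_top_of_isUnit_mem _ (Ideal.mem_map_of_mem ψ ?_) hunit
    rw [HomogeneousIdeal.mem_iff, HomogeneousIdeal.mem_irrelevant_iff, GradedRing.proj_apply,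
      DirectSum.decompose_of_mem_ne 𝒜 ha hd.ne']
  let f : Spec B ⟶ Proj 𝒜 := Proj.fromOfGlobalSections 𝒜 ψ hirr
  let j : Spec B ⟶ ProjectiveSpace 2 k := Spec.map (CommRingCat.ofHom ι) ≫ planeChartι k
  have : IsOpenImmersion j := by
    have : IsOpenImmersion (Spec.map (CommRingCat.ofHom ι)) :=
      Scheme.isOpenImmersion_SpecMap_localizationAway (R := .of (PlaneChart k)) z
    exact IsOpenImmersion.comp _ _
  have : IsDominant f := by
    refine ⟨?_⟩
    rw [DenseRange, dense_iff_inter_open]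
    rintro V hV ⟨x, hx⟩
    obtain ⟨_, ⟨r, rfl⟩, hxr, hrV⟩ :=
      (ProjectiveSpectrum.isTopologicalBasis_basic_opens 𝒜).exists_subset_of_mem_open hx hV
    obtain ⟨i, hi⟩ : ∃ i, GradedRing.proj 𝒜 i r ∉ x.asHomogeneousIdeal := by
      by_contra! hall
      refine hxr ((HomogeneousIdeal.mem_iff ..).mp ?_)
      rw [← DirectSum.sum_support_decompose 𝒜 r]
      exact sum_mem fun i _ => hall i
    -- The component of `r` may have degree 0. Multiplying it by an element of positive degree
    -- outside `x` gives a smaller basic neighbourhood `c ≠ 0` of `x` with `c` of positive degree,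
    -- whose preimage is the locus `ψ c ≠ 0`.
    obtain ⟨b, hb, hbx⟩ := SetLike.not_le_iff_exists.mp x.not_irrelevant_le
    obtain ⟨m, hm⟩ : ∃ m, GradedRing.proj 𝒜 m b ∉ x.asHomogeneousIdeal := by
      by_contra! hall
      refine hbx ?_
      rw [← DirectSum.sum_support_decompose 𝒜 b]
      exact sum_mem fun i _ => hall i
    have hm0 : 0 < m := Nat.pos_of_ne_zero fun h => hm (by
      rw [h, (HomogeneousIdeal.mem_irrelevant_iff _ _).mp hb]; exact zero_mem _)
    set c := GradedRing.proj 𝒜 i r * GradedRing.proj 𝒜 m b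
    have hc : c ∈ 𝒜 (i + m) := SetLike.mul_mem_graded (SetLike.coe_mem _) (SetLike.coe_mem _)
    have hcx : c ∉ x.asHomogeneousIdeal := fun h => (x.isPrime.mem_or_mem h).elim hi hm
    have hψc : ψ c ≠ 0 := fun h => hcx (by rw [hψ _ c hc h]; exact zero_mem _)
    have hne : (Spec B).basicOpen (ψ c) ≠ ⊥ := fun h => hψc ((basicOpen_eq_bot_iff _).mp h)
    rw [← Proj.fromOfGlobalSections_preimage_basicOpen 𝒜 ψ hirr (by omega) hc] at hne
    obtain ⟨y, hy⟩ := (TopologicalSpace.Opens.ne_bot_iff_nonempty _).mp hne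
    have hy' : c ∉ (f y).asHomogeneousIdeal := hy
    refine ⟨f y, hrV fun hr => hy' ?_, y, rfl⟩
    exact Ideal.mul_mem_right _ _ ((f y).asHomogeneousIdeal.isHomogeneous i hr)
  refine IsUnirational.of_isOpenImmersion j f ?_
  change f ≫ Proj.toSpecZero 𝒜 ≫ _ = _
  rw [Proj.fromOfGlobalSections_toSpecZero_assoc, Category.assoc, planeChartι_over,
    ← SpecMap_ΓSpecIso_hom, ← Spec.map_comp, ← Spec.map_comp, ← Spec.map_comp]
  congr 1
  ext r
  have h : planeChartMap k (φ (algebraMap k A r)) = planeConst k r := by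
    rw [φ.commutes]
    simp [planeChartMap, algebraMap_eq]
  simpa [ψ, ψ₀] using congrArg ι h

/-! ### Homogeneous independence by initial forms. -/

/-- Scaling the variables by powers of `τ` scales a weighted homogeneous polynomial. -/
theorem aeval_pow_mul {k R ι : Type*} [CommRing k] [CommRing R] [Algebra k R] {a : ι → ℕ} {n : ℕ}
    {p : MvPolynomial ι k} (hp : p.IsWeightedHomogeneous a n) (τ : R) (A : ι → R) :
    aeval (fun i => τ ^ a i * A i) p = τ ^ n * aeval A p := by
  simp only [aeval_def, eval₂_eq]
  rw [Finset.mul_sum]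
  refine Finset.sum_congr rfl fun d hd => ?_
  have h := hp (mem_support_iff.mp hd)
  rw [Finsupp.weight_apply, Finsupp.sum] at h
  simp only [mul_pow, Finset.prod_mul_distrib, ← pow_mul, Finset.prod_pow_eq_pow_sum]
  rw [show ∑ i ∈ d.support, a i * d i = n by rw [← h]; simp [mul_comm]]
  ring

/-- No nonzero polynomial that is homogeneous for the weights `w` vanishes at `A`. -/
def GradedIndependent (k : Type*) {R ι M : Type*} [CommRing k] [CommRing R] [Algebra k R]
    [AddCommMonoid M] (w : ι → M) (A : ι → R) : Prop :=
  ∀ (p : MvPolynomial ι k) (m : M), p.IsWeightedHomogeneous w m → aeval A p = 0 → p = 0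

/-- Passing to initial forms: `A i` is divisible by `τ ^ a i` with quotient `B i`, and `ε` is a
specialization that kills `τ`. -/
theorem GradedIndependent.of_initial {k R S ι M : Type*} [CommRing k] [CommRing R] [IsDomain R]
    [CommRing S] [Algebra k R] [Algebra k S] [AddCommMonoid M] {w : ι → M} {A B : ι → R}
    {a : ι → ℕ} (ε : R →ₐ[k] S) {τ : R} (hτ : τ ≠ 0) (hε : ε τ = 0)
    (hA : ∀ i, A i = τ ^ a i * B i)
    (h : GradedIndependent k (fun i => (w i, a i)) fun i => ε (B i)) :
    GradedIndependent k w A := by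
  classical
  intro p m hp hz
  obtain rfl : A = fun i => τ ^ a i * B i := funext hA
  by_contra hp0
  have hex : ∃ n, weightedHomogeneousComponent a n p ≠ 0 := by
    by_contra! hall
    exact hp0 (by rw [← sum_weightedHomogeneousComponent a p]; simp [hall])
  -- The lowest `a`-weight occurring in `p`. All higher components contribute multiples of τⁿ⁺¹, so
  -- after division by τⁿ only the component of weight `n` survives `ε`.
  set n := Nat.find hex with hn
  have hlow : ∀ j < n, weightedHomogeneousComponent a j p = 0 := fun j hj => by
    simpa using Nat.find_min hex hj
  have hfin : ∀ N, ∃ q : R, aeval (fun i => τ ^ a i * B i)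
      (∑ j ∈ Finset.range N, weightedHomogeneousComponent a (n + 1 + j) p) = τ ^ (n + 1) * q := by
    intro N
    rw [map_sum]
    refine ⟨∑ j ∈ Finset.range N, τ ^ j * aeval B (weightedHomogeneousComponent a (n + 1 + j) p), ?_⟩
    rw [Finset.mul_sum]
    refine Finset.sum_congr rfl fun j _ => ?_
    rw [aeval_pow_mul (weightedHomogeneousComponent_isWeightedHomogeneous _ _)]
    ring
  have hsum : ∃ N, p = weightedHomogeneousComponent a n p +
      ∑ j ∈ Finset.range N, weightedHomogeneousComponent a (n + 1 + j) p := by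
    obtain ⟨N, hN⟩ : ∃ N, ∀ j, N ≤ j → weightedHomogeneousComponent a j p = 0 := by
      refine ⟨weightedTotalDegree a p + 1, fun j hj =>
        weightedHomogeneousComponent_eq_zero' _ _ fun d hd => ?_⟩
      have := le_weightedTotalDegree a hd
      omega
    refine ⟨N, ?_⟩
    have e : p = ∑ j ∈ Finset.range (n + 1 + N), weightedHomogeneousComponent a j p := by
      conv_lhs => rw [← sum_weightedHomogeneousComponent a p]
      refine finsum_eq_sum_of_support_subset _ fun j hj => ?_
      simp only [Finset.coe_range, Set.mem_Iio]
      by_contra hlt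
      exact hj (hN j (by omega))
    conv_lhs => rw [e]
    rw [Finset.sum_range_add, Finset.sum_range_succ,
      Finset.sum_eq_zero fun j hj => hlow j (Finset.mem_range.mp hj), zero_add]
  obtain ⟨N, hN⟩ := hsum
  obtain ⟨q, hq⟩ := hfin N
  have h1 : aeval B (weightedHomogeneousComponent a n p) + τ * q = 0 := by
    rw [hN, map_add, hq,
      aeval_pow_mul (weightedHomogeneousComponent_isWeightedHomogeneous _ _)] at hz
    refine (mul_eq_zero.mp (?_ : τ ^ n * _ = 0)).resolve_left (pow_ne_zero _ hτ)
    rw [← hz]; ring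
  -- The component of weight `n` is homogeneous for `w` and `a` at once, so the hypothesis on the
  -- pairs of weights kills it.
  refine Nat.find_spec hex (h _ (m, n) ?_ ?_)
  · intro d hd
    rw [← hn, coeff_weightedHomogeneousComponent] at hd
    split_ifs at hd with hda
    · have := hp hd
      rw [← this, ← hda]
      simp only [Finsupp.weight_apply, Finsupp.sum]
      ext <;> simp [Prod.fst_sum, Prod.snd_sum]
    · exact absurd rfl hd
  · have := congrArg ε h1
    rw [map_add, map_mul, hε, zero_mul, add_zero, map_zero] at this
    rw [← hn, ← this]
    exact (DFunLike.congr_fun (comp_aeval B ε).symm _ : _)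

/-- If distinct monomials have distinct weights, homogeneous polynomials are monomials. -/
theorem GradedIndependent.of_injective {k R ι M : Type*} [Field k] [CommRing R] [IsDomain R]
    [Algebra k R] [AddCommMonoid M] {w : ι → M} {A : ι → R}
    (hw : Function.Injective (Finsupp.weight (R := ℕ) w)) (hA : ∀ i, A i ≠ 0) :
    GradedIndependent k w A := by
  classical
  intro p m hp hz
  by_contra hp0
  obtain ⟨d, hd⟩ := support_nonempty.mpr hp0
  have hmon : p = monomial d (coeff d p) := by
    ext d'
    rw [coeff_monomial]
    split_ifs with h
    · rw [h]
    · by_contra hd'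
      exact h (hw ((hp (mem_support_iff.mp hd)).trans (hp hd').symm))
  rw [hmon, aeval_monomial] at hz
  have hc : coeff d p ≠ 0 := mem_support_iff.mp hd
  rcases mul_eq_zero.mp hz with h | h
  · exact hc ((map_eq_zero_iff _ (algebraMap k R).injective).mp h)
  · exact Finset.prod_ne_zero_iff.mpr (fun i _ => pow_ne_zero _ (hA i)) h

/-- Three polynomials in `t, u` with initial forms `tᵃ u³`, `tᵇ`, `tᶜ` (up to scalars), where
`b ≠ c`, satisfy no homogeneous relation. -/
theorem algebraicIndependent_of_initial {k : Type u} [Field k]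
    {A B : Fin 3 → MvPolynomial (Fin 2) k} {a : Fin 3 → ℕ} (ha : a 1 ≠ a 2)
    {B' : Fin 3 → Polynomial k} (hA : ∀ i, A i = X 0 ^ a i * B i)
    (hB : ∀ i, aeval ![(0 : Polynomial k), Polynomial.X] (B i) =
      Polynomial.X ^ (![3, 0, 0] : Fin 3 → ℕ) i * B' i)
    (hB' : ∀ i, (B' i).coeff 0 ≠ 0) :
    AlgebraicIndependent k fun i => (Polynomial.X * Polynomial.C (A i) :
      Polynomial (MvPolynomial (Fin 2) k)) := by
  suffices h : GradedIndependent k (fun _ => (0 : ℕ)) fun i =>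
      (Polynomial.X * Polynomial.C (A i) : Polynomial (MvPolynomial (Fin 2) k)) by
    rw [algebraicIndependent_iff]
    exact fun p hp => h p 0 (fun d _ => by simp [Finsupp.weight_apply]) hp
  -- Three degenerations, along the scaling variable, t and u, each add one weight. The first turns
  -- algebraic independence into the absence of homogeneous relations.
  refine .of_initial (a := fun _ => 1) (B := fun i => Polynomial.C (A i))
    ((Polynomial.aeval (0 : MvPolynomial (Fin 2) k)).restrictScalars k)
    Polynomial.X_ne_zero (by simp) (by simp) ?_
  refine .of_initial (a := a) (B := B) (aeval ![(0 : Polynomial k), Polynomial.X])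
    (X_ne_zero (0 : Fin 2)) (by simp) (by simpa using hA) ?_
  refine .of_initial (a := ![3, 0, 0]) (B := B') (Polynomial.aeval (0 : k))
    Polynomial.X_ne_zero (by simp) hB ?_
  refine .of_injective (fun d e h => ?_) (by simpa [← Polynomial.coeff_zero_eq_aeval_zero] using hB')
  rw [Finsupp.weight_apply, Finsupp.weight_apply, Finsupp.sum_fintype _ _ (by simp),
    Finsupp.sum_fintype _ _ (by simp)] at h
  simp [Fin.sum_univ_three] at h
  obtain ⟨⟨h1, h2⟩, h3⟩ := h
  -- The u-weight fixes the exponent of index 0. The other two exponents solve a linear system with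
  -- determinant ±(a 1 - a 2).
  have h4 : ((a 1 : ℤ) - a 2) * (d 1 - e 1) = 0 := by
    zify at h1 h2 h3
    rw [h3] at h1 h2
    linear_combination h2 - a 2 * h1
  have h5 : d 1 = e 1 := by
    rcases mul_eq_zero.mp h4 with h | h <;> omega
  ext i
  fin_cases i
  · exact h3
  · exact h5
  · change d 2 = e 2
    omega

/-! ### The coordinate ring of the double plane. -/

/-- Modulo `c w² - H(x, y, z)` every polynomial is of the form `a + b w` with `a, b` polynomials
in `x, y, z`. -/
theorem exists_sub_mem_span {k : Type*} [Field k] {c : k} (hc : c ≠ 0)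
    (H : MvPolynomial (Fin 3) k) (p : MvPolynomial (Fin 4) k) :
    ∃ a b : MvPolynomial (Fin 3) k, p - (rename Fin.castSucc a + rename Fin.castSucc b * X 3) ∈
      Ideal.span {C c * X 3 ^ 2 - rename Fin.castSucc H} := by
  induction p using MvPolynomial.induction_on with
  | C r => exact ⟨C r, 0, by simp⟩
  | add p q hp hq =>
    obtain ⟨a, b, h⟩ := hp
    obtain ⟨a', b', h'⟩ := hq
    refine ⟨a + a', b + b', ?_⟩
    convert add_mem h h' using 1
    simp only [map_add]
    ring
  | mul_X p i hp =>
    obtain ⟨a, b, h⟩ := hp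
    induction i using Fin.lastCases with
    | last =>
      refine ⟨C c⁻¹ * H * b, a, ?_⟩
      have hcc : (C c⁻¹ : MvPolynomial (Fin 4) k) * C c = 1 := by
        rw [← C_mul, inv_mul_cancel₀ hc, C_1]
      convert add_mem (Ideal.mul_mem_right (X 3) _ h) (Ideal.mul_mem_left _
        (C c⁻¹ * rename Fin.castSucc b) (Ideal.mem_span_singleton_self _)) using 1
      simp only [map_mul, rename_C, Fin.reduceLast]
      linear_combination (- X 3 ^ 2 * rename Fin.castSucc b) * hcc
    | cast i =>
      refine ⟨a * X i, b * X i, ?_⟩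
      convert Ideal.mul_mem_right (X i.castSucc) _ h using 1
      simp only [map_mul, rename_X]
      ring

/-- A nonsquare of a field stays a nonsquare up to squares in polynomial rings. -/
theorem eq_zero_of_C_mul_sq_eq_sq {k σ : Type*} [Field k] [LinearOrder σ] [WellFoundedGT σ] {c : k}
    (hc : ¬IsSquare c) {a b : MvPolynomial σ k} (h : C c * a ^ 2 = b ^ 2) : b = 0 := by
  by_contra hb
  have h' := congrArg (MonomialOrder.lex (σ := σ)).leadingCoeff h
  have hc0 : c ≠ 0 := fun h0 => hc (h0 ▸ IsSquare.zero)
  have ha : a ≠ 0 := by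
    rintro rfl
    exact hb (pow_eq_zero_iff two_ne_zero |>.mp (by rw [← h]; simp))
  rw [pow_two, pow_two, MonomialOrder.leadingCoeff_mul, MonomialOrder.leadingCoeff_mul,
    MonomialOrder.leadingCoeff_mul, MonomialOrder.leadingCoeff_C] at h'
  have ha' : (MonomialOrder.lex (σ := σ)).leadingCoeff a ≠ 0 := by simpa using ha
  refine hc ⟨(MonomialOrder.lex (σ := σ)).leadingCoeff b /
    (MonomialOrder.lex (σ := σ)).leadingCoeff a, ?_⟩
  field_simp
  linear_combination h'

/-- The kernel of a point `(x : y : z : w)` of the surface `c w² = H(x, y, z)` with `x, y, z`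
algebraically independent is generated by the equation of the surface. -/
theorem mem_span_of_aeval_eq_zero {k R : Type*} [Field k] [CommRing R] [IsDomain R] [Algebra k R]
    {c : k} (hc : ¬IsSquare c) {H : MvPolynomial (Fin 3) k} (hH : (finSuccEquiv k 2 H).Monic)
    {x : Fin 4 → R} (hF : aeval x (C c * X 3 ^ 2 - rename Fin.castSucc H) = 0)
    (hx : AlgebraicIndependent k (x ∘ Fin.castSucc)) {p : MvPolynomial (Fin 4) k}
    (hp : aeval x p = 0) : p ∈ Ideal.span {C c * X 3 ^ 2 - rename Fin.castSucc H} := by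
  have hc0 : c ≠ 0 := fun h0 => hc (h0 ▸ IsSquare.zero)
  obtain ⟨a, b, h⟩ := exists_sub_mem_span hc0 H p
  have h0 : aeval x (rename Fin.castSucc a + rename Fin.castSucc b * X 3) = 0 := by
    obtain ⟨q, hq⟩ := Ideal.mem_span_singleton.mp h
    have := congrArg (aeval x) hq
    rw [map_mul, hF, zero_mul, map_sub, hp, zero_sub, neg_eq_zero] at this
    exact this
  simp only [map_add, map_mul, map_sub, map_pow, aeval_rename, aeval_X, aeval_C] at h0 hF
  -- The norm of a + b w, namely c (a + b w)(a - b w) = c a² - b² H, involves only x, y, z, whose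
  -- independence lifts the relation to polynomials.
  have hab : C c * a ^ 2 = b ^ 2 * H := by
    rw [← sub_eq_zero]
    refine hx.eq_zero_of_aeval_eq_zero _ ?_
    simp only [map_mul, map_sub, map_pow, aeval_C]
    linear_combination (algebraMap k R c) *
      (aeval (x ∘ Fin.castSucc) a - aeval (x ∘ Fin.castSucc) b * x 3) * h0 +
      (aeval (x ∘ Fin.castSucc) b) ^ 2 * hF
  -- `H` is monic in `X 0`, so comparing leading coefficients in that variable removes `H` and
  -- leaves c times a square equal to a square.
  have hb : b = 0 := by
    have hC : finSuccEquiv k 2 (C c) = Polynomial.C (C c) := (finSuccEquiv k 2).commutes c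
    have h1 := congrArg (fun q => (finSuccEquiv k 2 q).leadingCoeff) hab
    simp only [map_mul, map_pow, Polynomial.leadingCoeff_mul, Polynomial.leadingCoeff_pow, hC,
      hH.leadingCoeff, mul_one, Polynomial.leadingCoeff_C] at h1
    have h2 := eq_zero_of_C_mul_sq_eq_sq hc h1
    exact (map_eq_zero_iff _ (finSuccEquiv k 2).injective).mp (Polynomial.leadingCoeff_eq_zero.mp h2)
  have ha : a = 0 := by
    rw [hb] at hab
    have : C c ≠ (0 : MvPolynomial (Fin 3) k) := by simpa using hc0
    simpa [this] using hab
  simpa [ha, hb] using h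

/-- A parametrized family of points of `c w² = H(x, y, z)` whose plane coordinates satisfy no
homogeneous relation makes the surface unirational. -/
theorem isUnirational_quarticSurface {k : Type u} [Field k] {c : k} (hc : ¬IsSquare c)
    {H : MvPolynomial (Fin 3) k} (hH : (finSuccEquiv k 2 H).Monic) {F : MvPolynomial (Fin 4) k}
    (hF : F.IsWeightedHomogeneous wt 4) (hFH : F = C c * X 3 ^ 2 - rename Fin.castSucc H)
    {x : Fin 4 → MvPolynomial (Fin 2) k} (hx : aeval x F = 0)
    (hind : AlgebraicIndependent k fun i : Fin 3 =>
      (Polynomial.X * Polynomial.C (x i.castSucc) : Polynomial (MvPolynomial (Fin 2) k))) :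
    IsUnirational k 2 (QuarticSurface F hF) := by
  let I := quarticIdeal F hF
  have hI : I.toIdeal = Ideal.span {F} := rfl
  let φ : (MvPolynomial (Fin 4) k ⧸ I.toIdeal) →ₐ[k] MvPolynomial (Fin 2) k :=
    Ideal.Quotient.liftₐ I.toIdeal (aeval x) fun p hp => by
      obtain ⟨q, rfl⟩ := Ideal.mem_span_singleton.mp hp
      rw [map_mul, hx, zero_mul]
  have hφ : ∀ p, φ (Ideal.Quotient.mk I.toIdeal p) = aeval x p := fun p => rfl
  -- The scaling variable turns a homogeneous relation at `x` into a relation at a point with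
  -- algebraically independent plane coordinates. The map `φ` itself need only be injective on
  -- homogeneous elements.
  have hscale : ∀ n (p : MvPolynomial (Fin 4) k), p.IsWeightedHomogeneous wt n →
      aeval (fun i => (Polynomial.X ^ wt i * Polynomial.C (x i) :
        Polynomial (MvPolynomial (Fin 2) k))) p = Polynomial.X ^ n * Polynomial.C (aeval x p) := by
    intro n p hp
    rw [aeval_pow_mul hp]
    congr 1
    exact (DFunLike.congr_fun
      (comp_aeval x (Polynomial.CAlgHom (R := k) (A := MvPolynomial (Fin 2) k))).symm p :)
  refine isUnirational_proj (quotientGrading (weightedHomogeneousSubmodule k wt) I) φ one_pos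
    (a := Ideal.Quotient.mk I.toIdeal (X 2)) ⟨X 2, isWeightedHomogeneous_X k wt 2, rfl⟩ ?_ ?_
  · rw [hφ, aeval_X]
    intro h
    exact hind.ne_zero 2 (by simp only [Fin.reduceCastSucc, h, map_zero, mul_zero])
  · rintro n _ ⟨p, hp, rfl⟩ hp0
    have hp0 : aeval x p = 0 := hp0
    refine Ideal.Quotient.eq_zero_iff_mem.mpr ?_
    rw [hI, hFH]
    refine mem_span_of_aeval_eq_zero hc hH
      (x := fun i => (Polynomial.X ^ wt i * Polynomial.C (x i))) ?_ ?_ ?_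
    · rw [← hFH, hscale 4 F hF, hx, map_zero, mul_zero]
    · convert hind using 2 with i
      fin_cases i <;> simp [wt]
    · rw [hscale n p hp, hp0, map_zero, mul_zero]

/-! ### Residual points on lines in characteristic three. -/

section Parametrization

/-!
Let `P` be a point of the double plane `w² = h` and `v` a direction in the plane, and write
`w₀² + h₁ l + h₂ l² + h₃ l³ + h₄ l⁴` for the restriction of `h` to the line `P + l v`. The second
order Taylor polynomial of `w` at `P` cuts out a plane quartic with a triple point at `P`, whose
residual intersection with the line is a further point of the surface. In characteristic three it
is given by `l = N / D` with `e = h₁² - h₂ w₀²`, `D = h₄ w₀⁶ - e²`, `M = h₁ e - h₃ w₀⁴` and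
`N = w₀² M`. Below, `w₀` and the `hᵢ` are divisible by powers of a parameter `t`, and common
factors are removed.
-/

variable {R : Type*} [CommRing R]

/-- For w₀ = t w and (h₁, h₂, h₃, h₄) = (t² g₁, t⁴ g₂, t² g₃, g₄), the e, D, M above become t⁴ E, t⁶
D, t⁶ M, so l = t² w² M / D. As 1/2 = -1, the Taylor polynomial is w₀ - h₁ l / w₀ + e l² / w₀³. The
left side is the square of D² times it. -/
theorem sq_residualPoint (h3 : (3 : R) = 0) {t w g₁ g₂ g₃ g₄ E D M : R}
    (hE : E = g₁ ^ 2 - t ^ 2 * g₂ * w ^ 2) (hD : D = g₄ * w ^ 6 - t ^ 2 * E ^ 2)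
    (hM : M = g₁ * E - g₃ * w ^ 4) :
    (t * w * (D ^ 2 - t ^ 2 * D * M * g₁ + t ^ 4 * M ^ 2 * E)) ^ 2 =
      D ^ 4 * (t * w) ^ 2 + D ^ 3 * (t ^ 2 * w ^ 2 * M) * (t ^ 2 * g₁) +
        D ^ 2 * (t ^ 2 * w ^ 2 * M) ^ 2 * (t ^ 4 * g₂) +
        D * (t ^ 2 * w ^ 2 * M) ^ 3 * (t ^ 2 * g₃) + (t ^ 2 * w ^ 2 * M) ^ 4 * g₄ := by
  linear_combination (-t ^ 4 * g₁ * D ^ 3 * w ^ 2 * M + t ^ 6 * E * D ^ 2 * w ^ 2 * M ^ 2 -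
    t ^ 8 * g₁ * E * D * w ^ 2 * M ^ 3) * h3 - t ^ 6 * w ^ 2 * M ^ 2 * D ^ 2 * hE -
    t ^ 8 * w ^ 2 * D * M ^ 3 * hM + t ^ 8 * w ^ 2 * M ^ 4 * hD

/-- The same identity for w₀ = t² w and (h₁, h₂, h₃, h₄) = (t³ g₁, 0, t g₃, g₄). The e, D, M above
become t⁶ E, t¹² D, t⁹ M, so l = t w² M / D. -/
theorem sq_residualPoint_of_cusp (h3 : (3 : R) = 0) {t w g₁ g₃ g₄ E D M : R}
    (hE : E = g₁ ^ 2) (hD : D = g₄ * w ^ 6 - E ^ 2) (hM : M = g₁ * E - g₃ * w ^ 4) :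
    (t ^ 2 * w * (D ^ 2 - D * M * g₁ + M ^ 2 * E)) ^ 2 =
      D ^ 4 * (t ^ 2 * w) ^ 2 + D ^ 3 * (t * w ^ 2 * M) * (t ^ 3 * g₁) +
        D * (t * w ^ 2 * M) ^ 3 * (t * g₃) + (t * w ^ 2 * M) ^ 4 * g₄ := by
  linear_combination (t ^ 4 * w ^ 2 * (-g₁ * D ^ 3 * M + E * D ^ 2 * M ^ 2 -
    g₁ * E * D * M ^ 3)) * h3 - t ^ 4 * w ^ 2 * M ^ 2 * D ^ 2 * hE -
    t ^ 4 * w ^ 2 * D * M ^ 3 * hM + t ^ 4 * w ^ 2 * M ^ 4 * hD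

/-- Taylor expansion along P + (N / D)(1, b, 0), cleared of denominators. Cubing is additive, so y³z
- yz³ contributes no N² term. -/
theorem quartic₁_add (h3 : (3 : R) = 0) (D N x y z b : R) :
    ((D * x + N) ^ 2 + (D * y + N * b) ^ 2) ^ 2 + (D * y + N * b) ^ 3 * (D * z) -
        (D * y + N * b) * (D * z) ^ 3 =
      D ^ 4 * ((x ^ 2 + y ^ 2) ^ 2 + y ^ 3 * z - y * z ^ 3) +
        D ^ 3 * N * ((x ^ 2 + y ^ 2) * (x + y * b) - b * z ^ 3) +
        D ^ 2 * N ^ 2 * ((x + y * b) ^ 2 - (x ^ 2 + y ^ 2) * (1 + b ^ 2)) +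
        D * N ^ 3 * ((1 + b ^ 2) * (x + y * b) + z * b ^ 3) + N ^ 4 * (1 + b ^ 2) ^ 2 := by
  linear_combination (D ^ 3 * N * (x ^ 2 + y ^ 2) * (x + y * b) +
    D ^ 2 * N ^ 2 * ((x + y * b) ^ 2 + (x ^ 2 + y ^ 2) * (1 + b ^ 2)) +
    D * N ^ 3 * (x + y * b) * (1 + b ^ 2) +
    z * D * (D ^ 2 * y ^ 2 * N * b + D * y * N ^ 2 * b ^ 2)) * h3

/-- Here the N² term is absent altogether, since 6 = 0 removes it from the fourth power as well. -/
theorem quartic₂_add (h3 : (3 : R) = 0) (D N x y z b : R) :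
    (D * x + N) ^ 4 + (D * y + N * b) ^ 3 * (D * z) - (D * y + N * b) * (D * z) ^ 3 =
      D ^ 4 * (x ^ 4 + y ^ 3 * z - y * z ^ 3) + D ^ 3 * N * (x ^ 3 - b * z ^ 3) +
        D * N ^ 3 * (x + z * b ^ 3) + N ^ 4 := by
  linear_combination (D ^ 3 * N * x ^ 3 + 2 * D ^ 2 * N ^ 2 * x ^ 2 + D * N ^ 3 * x +
    z * D * (D ^ 2 * y ^ 2 * N * b + D * y * N ^ 2 * b ^ 2)) * h3

theorem quartic₃_add (h3 : (3 : R) = 0) (D N x y z m : R) :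
    (D * x + N) ^ 4 + (D * y + N * m) ^ 4 + (D * z) ^ 4 =
      D ^ 4 * (x ^ 4 + y ^ 4 + z ^ 4) + D ^ 3 * N * (x ^ 3 + y ^ 3 * m) +
        D * N ^ 3 * (x + y * m ^ 3) + N ^ 4 * (1 + m ^ 4) := by
  linear_combination (D ^ 3 * N * (x ^ 3 + y ^ 3 * m) +
    2 * D ^ 2 * N ^ 2 * (x ^ 2 + y ^ 2 * m ^ 2) + D * N ^ 3 * (x + y * m ^ 3)) * h3

end Parametrization

/-! ### The curves and parametrizations on the three surfaces. -/

theorem three_eq_zero_of_algebra (k : Type*) {R : Type*} [CommRing k] [CharP k 3] [CommRing R]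
    [Algebra k R] : (3 : R) = 0 := by
  have h : (3 : k) = 0 := by exact_mod_cast CharP.cast_eq_zero k 3
  rw [← map_ofNat (algebraMap k R) 3, h, map_zero]

theorem not_isSquare_neg_one_zmod_three : ¬IsSquare (-1 : ZMod 3) := by
  decide

theorem isUnirational_X₂ : IsUnirational (ZMod 3) 2 X₂ := by
  have h3 : (3 : MvPolynomial (Fin 2) (ZMod 3)) = 0 := three_eq_zero_of_algebra (ZMod 3)
  let t : MvPolynomial (Fin 2) (ZMod 3) := X 0
  -- The lines have direction (1, t³ m, 0). The shift by 1 makes `g₁` specialize to u at t = 0.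
  let m : MvPolynomial (Fin 2) (ZMod 3) := X 1 - 1
  let ε := aeval (R := ZMod 3) ![(0 : Polynomial (ZMod 3)), Polynomial.X]
  have hεt : ε t = 0 := by simp [ε, t]
  have hεm : ε m = Polynomial.X - 1 := by simp [ε, m]
  -- The curve is (t x : -t⁴ : z : t² w). At t = 0 it lies over the hyperflex (0 : 0 : 1) with
  -- tangent y = 0, the limit of the lines.
  obtain ⟨x, hx⟩ : ∃ x, x = (t ^ 2 + 1) * (t ^ 4 - 1) := ⟨_, rfl⟩
  obtain ⟨z, hz⟩ : ∃ z, z = t ^ 8 + 1 := ⟨_, rfl⟩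
  obtain ⟨w, hw⟩ : ∃ w, w = (t ^ 2 + 1) * (t ^ 10 - 1) := ⟨_, rfl⟩
  have hcurve : -(t ^ 2 * w) ^ 2 = (t * x) ^ 4 + (-t ^ 4) ^ 3 * z - (-t ^ 4) * z ^ 3 := by
    subst hx hz hw
    clear_value t
    grind
  obtain ⟨g₁, hg₁⟩ : ∃ g, g = m * z ^ 3 - x ^ 3 := ⟨_, rfl⟩
  obtain ⟨g₃, hg₃⟩ : ∃ g, g = -(x + z * t ^ 8 * m ^ 3) := ⟨_, rfl⟩
  obtain ⟨E, hE⟩ : ∃ E, E = g₁ ^ 2 := ⟨_, rfl⟩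
  obtain ⟨D, hD⟩ : ∃ D, D = -1 * w ^ 6 - E ^ 2 := ⟨_, rfl⟩
  obtain ⟨M, hM⟩ : ∃ M, M = g₁ * E - g₃ * w ^ 4 := ⟨_, rfl⟩
  have hεx : ε x = -1 := by simp [hx, hεt]
  have hεz : ε z = 1 := by simp [hz, hεt]
  have hεw : ε w = -1 := by simp [hw, hεt]
  have hεg₁ : ε g₁ = Polynomial.X := by
    simp [hg₁, hεm, hεx, hεz, Odd.neg_one_pow (by decide : Odd 3)]
  have hεg₃ : ε g₃ = 1 := by simp [hg₃, hεt, hεx]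
  have hεD : ε D = -(1 + Polynomial.X ^ 4) := by
    simp only [hD, hE, map_sub, map_mul, map_pow, map_neg, map_one, hεw, hεg₁]; ring
  have hεM : ε M = Polynomial.X ^ 3 - 1 := by
    simp only [hM, hE, map_sub, map_mul, map_pow, hεw, hεg₁, hεg₃]; ring
  refine isUnirational_quarticSurface (c := -1) not_isSquare_neg_one_zmod_three
    (H := X 0 ^ 4 + X 1 ^ 3 * X 2 - X 1 * X 2 ^ 3) ?_ F₂_homogeneous ?_
    (x := ![D * (t * x) + t * w ^ 2 * M, D * (-t ^ 4) + t * w ^ 2 * M * (t ^ 3 * m), D * z,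
      t ^ 2 * w * (D ^ 2 - D * M * g₁ + M ^ 2 * E)]) ?_ ?_
  · have h : finSuccEquiv (ZMod 3) 2 (X 0 ^ 4 + X (Fin.succ 0) ^ 3 * X (Fin.succ 1) -
        X (Fin.succ 0) * X (Fin.succ 1) ^ 3) =
          Polynomial.X ^ 4 + Polynomial.C (X 0 ^ 3 * X 1 - X 0 * X 1 ^ 3) := by
      simp only [map_sub, map_add, map_mul, map_pow, finSuccEquiv_X_zero, finSuccEquiv_X_succ]
      ring
    exact h ▸ Polynomial.monic_X_pow_add_C _ four_ne_zero
  · simp [F₂]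
  · have h1 := sq_residualPoint_of_cusp h3 (t := t) hE hD hM
    have h2 := quartic₂_add h3 D (t * w ^ 2 * M) (t * x) (-t ^ 4) z (t ^ 3 * m)
    simp only [F₂, map_sub, map_neg, map_add, map_mul, map_pow, aeval_X, Matrix.cons_val]
    rw [h2, h1, ← hcurve, hg₁, hg₃]
    ring
  -- At t = 0 the constant terms of D x and w² M cancel, which leaves u³ (1 + u).
  · refine algebraicIndependent_of_initial (a := ![1, 4, 0])
      (B := ![D * x + w ^ 2 * M, -D + w ^ 2 * M * m, D * z])
      (B' := ![1 + Polynomial.X, 1 + Polynomial.X ^ 4 + (Polynomial.X ^ 3 - 1) * (Polynomial.X - 1),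
        -(1 + Polynomial.X ^ 4)]) (by decide) ?_ ?_ ?_
    · intro i
      fin_cases i <;> simp <;> ring
    · change ∀ i, ε _ = _
      intro i
      fin_cases i
      · simp only [hεx, hεw, hεD, hεM, map_add, map_mul, map_pow, Fin.zero_eta, Matrix.cons_val]
        ring
      · simp [hεw, hεD, hεM, hεm]
      · simp [hεz, hεD]
    · intro i
      fin_cases i <;> simp [Polynomial.coeff_zero_eq_eval_zero]
      decide

theorem isUnirational_X₁ : IsUnirational (ZMod 3) 2 X₁ := by
  have h3 : (3 : MvPolynomial (Fin 2) (ZMod 3)) = 0 := three_eq_zero_of_algebra (ZMod 3)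
  let t : MvPolynomial (Fin 2) (ZMod 3) := X 0
  let s : MvPolynomial (Fin 2) (ZMod 3) := X 1
  let ε := aeval (R := ZMod 3) ![(0 : Polynomial (ZMod 3)), Polynomial.X]
  have hεt : ε t = 0 := by simp [ε, t]
  have hεs : ε s = Polynomial.X := by simp [ε, s]
  -- The curve is (t² x : t² y : z : t w), again over the hyperflex (0 : 0 : 1) at t = 0. The lines
  -- have direction (1, t² s, 0).
  obtain ⟨x, hx⟩ : ∃ x, x = t ^ 2 - 1 := ⟨_, rfl⟩
  obtain ⟨y, hy⟩ : ∃ y, y = (t ^ 2 - 1) ^ 2 := ⟨_, rfl⟩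
  obtain ⟨z, hz⟩ : ∃ z, z = t ^ 8 - t ^ 2 + 1 := ⟨_, rfl⟩
  obtain ⟨w, hw⟩ : ∃ w, w = (t ^ 2 - 1) * (t ^ 4 + 1) * (t ^ 8 + 1) := ⟨_, rfl⟩
  have hcurve : -(t * w) ^ 2 = ((t ^ 2 * x) ^ 2 + (t ^ 2 * y) ^ 2) ^ 2 + (t ^ 2 * y) ^ 3 * z -
      (t ^ 2 * y) * z ^ 3 := by
    subst hx hy hz hw
    clear_value t
    grind
  obtain ⟨q, hq⟩ : ∃ q, q = 1 + (t ^ 2 * s) ^ 2 := ⟨_, rfl⟩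
  obtain ⟨l, hl⟩ : ∃ l, l = x + y * (t ^ 2 * s) := ⟨_, rfl⟩
  obtain ⟨g₁, hg₁⟩ : ∃ g, g = s * z ^ 3 - t ^ 4 * (x ^ 2 + y ^ 2) * l := ⟨_, rfl⟩
  obtain ⟨g₂, hg₂⟩ : ∃ g, g = (x ^ 2 + y ^ 2) * q - l ^ 2 := ⟨_, rfl⟩
  obtain ⟨g₃, hg₃⟩ : ∃ g, g = -(q * l + z * t ^ 4 * s ^ 3) := ⟨_, rfl⟩
  obtain ⟨E, hE⟩ : ∃ E, E = g₁ ^ 2 - t ^ 2 * g₂ * w ^ 2 := ⟨_, rfl⟩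
  obtain ⟨D, hD⟩ : ∃ D, D = -q ^ 2 * w ^ 6 - t ^ 2 * E ^ 2 := ⟨_, rfl⟩
  obtain ⟨M, hM⟩ : ∃ M, M = g₁ * E - g₃ * w ^ 4 := ⟨_, rfl⟩
  have hεx : ε x = -1 := by simp [hx, hεt]
  have hεy : ε y = 1 := by simp [hy, hεt]
  have hεz : ε z = 1 := by simp [hz, hεt]
  have hεw : ε w = -1 := by simp [hw, hεt]
  have hεq : ε q = 1 := by simp [hq, hεt]
  have hεl : ε l = -1 := by simp [hl, hεt, hεx]
  have hεg₁ : ε g₁ = Polynomial.X := by simp [hg₁, hεt, hεs, hεz]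
  have hεg₃ : ε g₃ = 1 := by simp [hg₃, hεt, hεq, hεl]
  have hεE : ε E = Polynomial.X ^ 2 := by simp [hE, hεt, hεg₁]
  have hεD : ε D = -1 := by
    simp only [hD, map_sub, map_mul, map_pow, map_neg, hεw, hεq, hεt]; ring
  have hεM : ε M = Polynomial.X ^ 3 - 1 := by
    simp only [hM, map_sub, map_mul, map_pow, hεw, hεg₁, hεg₃, hεE]; ring
  refine isUnirational_quarticSurface (c := -1) not_isSquare_neg_one_zmod_three
    (H := (X 0 ^ 2 + X 1 ^ 2) ^ 2 + X 1 ^ 3 * X 2 - X 1 * X 2 ^ 3) ?_ F₁_homogeneous ?_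
    (x := ![D * (t ^ 2 * x) + t ^ 2 * w ^ 2 * M,
      D * (t ^ 2 * y) + t ^ 2 * w ^ 2 * M * (t ^ 2 * s), D * z,
      t * w * (D ^ 2 - t ^ 2 * D * M * g₁ + t ^ 4 * M ^ 2 * E)]) ?_ ?_
  · have h : finSuccEquiv (ZMod 3) 2 ((X 0 ^ 2 + X (Fin.succ 0) ^ 2) ^ 2 +
        X (Fin.succ 0) ^ 3 * X (Fin.succ 1) - X (Fin.succ 0) * X (Fin.succ 1) ^ 3) =
          Polynomial.X ^ 4 + (Polynomial.C (2 * X 0 ^ 2) * Polynomial.X ^ 2 +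
            Polynomial.C (X 0 ^ 4 + X 0 ^ 3 * X 1 - X 0 * X 1 ^ 3)) := by
      simp only [map_sub, map_add, map_mul, map_pow, map_ofNat, finSuccEquiv_X_zero,
        finSuccEquiv_X_succ]
      ring
    exact h ▸ Polynomial.monic_X_pow_add ((by compute_degree :
      Polynomial.degree _ ≤ 2).trans_lt (by norm_num))
  · simp [F₁]
  · have h1 := sq_residualPoint h3 (t := t) (g₂ := g₂) hE hD hM
    have h2 := quartic₁_add h3 D (t ^ 2 * w ^ 2 * M) (t ^ 2 * x) (t ^ 2 * y) z (t ^ 2 * s)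
    simp only [F₁, map_sub, map_neg, map_add, map_mul, map_pow, aeval_X, Matrix.cons_val]
    rw [h2, h1, ← hcurve, hg₁, hg₂, hg₃, hl, hq]
    ring
  -- At t = 0 the sum D x + w² M is 1 + (u³ - 1) = u³.
  · refine algebraicIndependent_of_initial (a := ![2, 2, 0])
      (B := ![D * x + w ^ 2 * M, D * y + t ^ 2 * w ^ 2 * M * s, D * z])
      (B' := ![1, -1, -1]) (by decide) ?_ ?_ ?_
    · intro i
      fin_cases i <;> simp <;> ring
    · change ∀ i, ε _ = _
      intro i
      fin_cases i
      · simp [hεx, hεw, hεD, hεM]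
      · simp [hεt, hεy, hεD]
      · simp [hεz, hεD]
    · intro i
      fin_cases i <;> simp

/-- An element of order eight is not a square in the field with nine elements. -/
theorem not_isSquare_of_sq_eq_add_one {γ : GaloisField 3 2} (hγ : γ ^ 2 = γ + 1) :
    ¬IsSquare γ := by
  rintro ⟨δ, rfl⟩
  have h3 : (3 : GaloisField 3 2) = 0 := by exact_mod_cast CharP.cast_eq_zero (GaloisField 3 2) 3
  have hδ : δ ≠ 0 := by
    rintro rfl
    simp at hγ
  have hcard : Nat.card (GaloisField 3 2) = 9 := by rw [GaloisField.card 3 2 two_ne_zero]; rfl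
  have h8 : δ ^ 8 = 1 := by
    have := Fintype.ofFinite (GaloisField 3 2)
    have h := FiniteField.pow_card_sub_one_eq_one δ hδ
    rwa [← Nat.card_eq_fintype_card, hcard] at h
  -- γ⁴ = (γ + 1)² = 3γ + 2 = -1, whereas γ⁴ = δ⁸ = 1.
  have h1 : (1 : GaloisField 3 2) = 0 := by
    linear_combination h8 - (δ ^ 4 + δ ^ 2 + 2) * hγ - δ ^ 2 * h3
  exact one_ne_zero h1

theorem isUnirational_X₃ {γ : GaloisField 3 2} (hγ : γ ^ 2 = γ + 1) :
    IsUnirational (GaloisField 3 2) 2 (X₃ γ) := by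
  have h3 : (3 : MvPolynomial (Fin 2) (GaloisField 3 2)) = 0 :=
    three_eq_zero_of_algebra (GaloisField 3 2)
  have h3' : (3 : Polynomial (GaloisField 3 2)) = 0 := three_eq_zero_of_algebra (GaloisField 3 2)
  let t : MvPolynomial (Fin 2) (GaloisField 3 2) := X 0
  let s : MvPolynomial (Fin 2) (GaloisField 3 2) := X 1
  let c : MvPolynomial (Fin 2) (GaloisField 3 2) := C γ
  let c' : Polynomial (GaloisField 3 2) := Polynomial.C γ
  have hc : c ^ 2 = c + 1 := by simp only [c, ← C_pow, hγ, C_add, C_1]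
  have hc' : c' ^ 2 = c' + 1 := by simp only [c', ← map_pow, hγ, map_add, map_one]
  let ε := aeval (R := GaloisField 3 2) ![(0 : Polynomial (GaloisField 3 2)), Polynomial.X]
  have hεt : ε t = 0 := by simp [ε, t]
  have hεs : ε s = Polynomial.X := by simp [ε, s]
  have hεc : ε c = c' := by simp [ε, c, c']
  obtain ⟨x, hx⟩ : ∃ x, x = (t ^ 4 + 1) * (t ^ 2 - 1 + c) := ⟨_, rfl⟩
  obtain ⟨y, hy⟩ : ∃ y, y = (t ^ 4 - 1) * (t ^ 2 + 1 - c) := ⟨_, rfl⟩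
  obtain ⟨z, hz⟩ : ∃ z, z = (t ^ 4 + c + 1) * (t ^ 2 - c) := ⟨_, rfl⟩
  obtain ⟨w, hw⟩ : ∃ w, w = (c + 1) * (t ^ 8 - 1) * (t ^ 2 + c) := ⟨_, rfl⟩
  -- The curve (x : y : z : t w) lies over the hyperflex (1 : 1 : 1) at t = 0. The forms x - y and x
  -- + y + z vanish there and are divisible by t² on the curve; the second is the tangent, of
  -- direction (1, -1, 0).
  obtain ⟨d, hd⟩ : ∃ d, d = (1 - c) * t ^ 2 - 1 := ⟨_, rfl⟩
  obtain ⟨r, hr⟩ : ∃ r, r = 1 + c - c * t ^ 2 := ⟨_, rfl⟩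
  have hcurve : c * (t * w) ^ 2 = x ^ 4 + y ^ 4 + z ^ 4 := by
    subst hx hy hz hw
    clear_value t c
    grind
  have hxy : x - y = t ^ 2 * d := by
    subst hx hy hd
    clear_value t c
    grind
  have hxyz : x + y + z = t ^ 2 * r := by
    subst hx hy hz hr
    clear_value t c
    grind
  -- Since c (c - 1) = 1, the factor c - 1 rewrites the equation as w² = γ⁻¹ (x⁴ + y⁴ + z⁴). The
  -- lines have direction (1, t² s - 1, 0).
  obtain ⟨g₁, hg₁⟩ : ∃ g, g = (c - 1) * (t ^ 4 * d ^ 3 + y ^ 3 * s) := ⟨_, rfl⟩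
  obtain ⟨g₃, hg₃⟩ : ∃ g, g = (c - 1) * (d + t ^ 4 * y * s ^ 3) := ⟨_, rfl⟩
  obtain ⟨g₄, hg₄⟩ : ∃ g, g = (c - 1) * (1 + (t ^ 2 * s - 1) ^ 4) := ⟨_, rfl⟩
  obtain ⟨E, hE⟩ : ∃ E, E = g₁ ^ 2 - t ^ 2 * 0 * w ^ 2 := ⟨_, rfl⟩
  obtain ⟨D, hD⟩ : ∃ D, D = g₄ * w ^ 6 - t ^ 2 * E ^ 2 := ⟨_, rfl⟩
  obtain ⟨M, hM⟩ : ∃ M, M = g₁ * E - g₃ * w ^ 4 := ⟨_, rfl⟩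
  have hεy : ε y = c' - 1 := by simp [hy, hεt, hεc]
  have hεz : ε z = c' - 1 := by
    simp only [hz, map_mul, map_sub, map_add, map_pow, map_one, hεt, hεc]
    linear_combination -hc' - c' * h3'
  have hεw : ε w = c' - 1 := by
    simp only [hw, map_mul, map_sub, map_add, map_pow, map_one, hεt, hεc]
    linear_combination -hc' - c' * h3'
  have hεd : ε d = -1 := by simp [hd, hεt]
  have hεr : ε r = c' + 1 := by simp [hr, hεt, hεc, add_comm]
  have hεg₁ : ε g₁ = -Polynomial.X := by
    simp only [hg₁, map_mul, map_sub, map_add, map_pow, map_one, hεt, hεc, hεs, hεy]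
    linear_combination Polynomial.X * (c' ^ 2 + 1) * hc' +
      Polynomial.X * (1 - c' + 2 * c' ^ 2 - c' ^ 3) * h3'
  have hεg₃ : ε g₃ = 1 - c' := by simp [hg₃, hεt, hεc, hεd]
  have hεg₄ : ε g₄ = 1 - c' := by
    simp only [hg₄, map_mul, map_sub, map_add, map_pow, map_one, hεt, hεc]
    linear_combination (c' - 1) * h3'
  have hεE : ε E = Polynomial.X ^ 2 := by simp [hE, hεg₁]
  have hεD : ε D = -c' := by
    simp only [hD, map_sub, map_mul, map_pow, hεw, hεg₄, hεt]
    linear_combination (-1 + c' + c' ^ 2 - c' ^ 3 - c' ^ 5) * hc' +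
      (-2 * c' + 8 * c' ^ 2 - 12 * c' ^ 3 + 11 * c' ^ 4 - 7 * c' ^ 5 + 2 * c' ^ 6) * h3'
  have hεM : ε M = -Polynomial.X ^ 3 + 1 - c' := by
    simp only [hM, map_sub, map_mul, map_pow, hεw, hεg₁, hεg₃, hεE]
    linear_combination (-1 + c' - c' ^ 2 + c' ^ 3) * hc' +
      (-1 + 2 * c' - 3 * c' ^ 2 + 3 * c' ^ 3 - c' ^ 4) * h3'
  refine isUnirational_quarticSurface (c := γ) (not_isSquare_of_sq_eq_add_one hγ)
    (H := X 0 ^ 4 + X 1 ^ 4 + X 2 ^ 4) ?_ (F₃_homogeneous γ) ?_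
    (x := ![D * x + t ^ 2 * w ^ 2 * M, D * y + t ^ 2 * w ^ 2 * M * (t ^ 2 * s - 1), D * z,
      t * w * (D ^ 2 - t ^ 2 * D * M * g₁ + t ^ 4 * M ^ 2 * E)]) ?_ ?_
  · have h : finSuccEquiv (GaloisField 3 2) 2
        (X 0 ^ 4 + X (Fin.succ 0) ^ 4 + X (Fin.succ 1) ^ 4) =
          Polynomial.X ^ 4 + Polynomial.C (X 0 ^ 4 + X 1 ^ 4) := by
      simp only [map_add, map_pow, finSuccEquiv_X_zero, finSuccEquiv_X_succ]
      ring
    exact h ▸ Polynomial.monic_X_pow_add_C _ four_ne_zero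
  · simp [F₃]
  · have h1 := sq_residualPoint h3 (t := t) (g₂ := 0) hE hD hM
    have h2 := quartic₃_add h3 D (t ^ 2 * w ^ 2 * M) x y z (t ^ 2 * s - 1)
    have hl₁ : c * (t ^ 2 * g₁) = x ^ 3 + y ^ 3 * (t ^ 2 * s - 1) := by
      rw [hg₁]
      linear_combination t ^ 2 * (t ^ 4 * d ^ 3 + y ^ 3 * s) * hc - congrArg (· ^ 3) hxy -
        x * y * (x - y) * h3
    have hl₃ : c * (t ^ 2 * g₃) = x + y * (t ^ 2 * s - 1) ^ 3 := by
      rw [hg₃]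
      linear_combination t ^ 2 * (d + t ^ 4 * y * s ^ 3) * hc - hxy +
        y * ((t ^ 2 * s) ^ 2 - t ^ 2 * s) * h3
    have hl₄ : c * g₄ = 1 + (t ^ 2 * s - 1) ^ 4 := by
      rw [hg₄]
      linear_combination (1 + (t ^ 2 * s - 1) ^ 4) * hc
    simp only [F₃, map_sub, map_add, map_mul, map_pow, aeval_X, aeval_C, Matrix.cons_val]
    rw [h2, h1, ← hcurve, ← hl₁, ← hl₃, ← hl₄]
    change c * _ - _ = _
    ring
  -- Independence is first shown for x - y, x + y + z and z of the residual point, coordinates that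
  -- place the hyperflex at (0 : 0 : 1). The invertible linear change `hlin` then returns to x, y,
  -- z.
  · have key : AlgebraicIndependent (GaloisField 3 2) fun i : Fin 3 => (Polynomial.X *
        Polynomial.C ((![t ^ 2 * (D * d + w ^ 2 * M * (2 - t ^ 2 * s)),
          t ^ 2 * (D * r + w ^ 2 * M * (t ^ 2 * s)), D * z] :
            Fin 3 → MvPolynomial (Fin 2) (GaloisField 3 2)) i) :
          Polynomial (MvPolynomial (Fin 2) (GaloisField 3 2))) := by
      refine algebraicIndependent_of_initial (a := ![2, 2, 0])
        (B := ![D * d + w ^ 2 * M * (2 - t ^ 2 * s), D * r + w ^ 2 * M * (t ^ 2 * s), D * z])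
        (B' := ![-c' - 1, c' - 1, -1]) (by decide) ?_ ?_ ?_
      · intro i
        fin_cases i <;> simp [t]
      · change ∀ i, ε _ = _
        intro i
        fin_cases i
        · have hε2 : ε 2 = 2 := map_ofNat ε 2
          simp [hεt, hεd, hεw, hεD, hεM, hε2]
          linear_combination (1 + c' + Polynomial.X ^ 3) * hc' +
            (1 - c' + 2 * c' ^ 2 - c' ^ 3 + 2 * Polynomial.X ^ 3 * c' -
              Polynomial.X ^ 3 * c' ^ 2) * h3'
        · simp [hεt, hεr, hεD]
          linear_combination -hc' - c' * h3'
        · simp [hεz, hεD]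
          linear_combination hc'
      · have h₁ : -γ - 1 ≠ 0 := fun h => one_ne_zero (α := GaloisField 3 2) <| by
          linear_combination hγ + (γ - 2) * h
        have h₂ : γ - 1 ≠ 0 := fun h => one_ne_zero (α := GaloisField 3 2) <| by
          linear_combination γ * h - hγ
        intro i
        fin_cases i
        · simpa [c'] using h₁
        · simpa [c'] using h₂
        · simp
    have h3₃ : (3 : MvPolynomial (Fin 3) (GaloisField 3 2)) = 0 :=
      three_eq_zero_of_algebra (GaloisField 3 2)
    have hlin : AlgebraicIndependent (GaloisField 3 2)
        (![-(X 0 + X 1 - X 2), X 0 - X 1 + X 2, X 2] :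
          Fin 3 → MvPolynomial (Fin 3) (GaloisField 3 2)) := by
      apply AlgebraicIndependent.of_aeval (x := (![X 0 - X 1, X 0 + X 1 + X 2, X 2] :
        Fin 3 → MvPolynomial (Fin 3) (GaloisField 3 2)))
      convert MvPolynomial.algebraicIndependent_X (Fin 3) (GaloisField 3 2) using 2 with i
      fin_cases i
      · simp
        linear_combination -X 0 * h3₃
      · simp
        linear_combination -X 1 * h3₃
      · simp
    convert key.aeval_of_algebraicIndependent hlin using 2 with i
    have h3₄ := congrArg (Polynomial.C (R := MvPolynomial (Fin 2) (GaloisField 3 2))) h3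
    have hxy' := congrArg Polynomial.C hxy
    have hxyz' := congrArg Polynomial.C hxyz
    simp only [map_sub, map_add, map_mul, map_pow, map_ofNat, map_zero] at h3₄ hxy' hxyz'
    fin_cases i
    · simp only [Fin.zero_eta, Fin.castSucc_zero, Matrix.cons_val, map_neg, map_sub, map_add,
        map_mul, map_pow, map_ofNat, aeval_X]
      linear_combination Polynomial.X * (Polynomial.C D * Polynomial.C x +
        Polynomial.C t ^ 2 * Polynomial.C w ^ 2 * Polynomial.C M) * h3₄ -
        Polynomial.X * Polynomial.C D * (hxy' + hxyz')
    · simp only [Fin.mk_one, Fin.castSucc_one, Matrix.cons_val, map_sub, map_add,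
        map_mul, map_pow, map_one, map_ofNat, aeval_X]
      linear_combination Polynomial.X * (Polynomial.C D * Polynomial.C y +
        Polynomial.C t ^ 2 * Polynomial.C w ^ 2 * Polynomial.C M *
          (Polynomial.C t ^ 2 * Polynomial.C s - 1)) * h3₄ +
        Polynomial.X * Polynomial.C D * (hxy' - hxyz')
    · simp
      ring

end DelPezzoTwo

end

theorem theorem3p3 :
    DelPezzoTwo.IsUnirational (ZMod 3) 2 DelPezzoTwo.X₁ ∧
    DelPezzoTwo.IsUnirational (ZMod 3) 2 DelPezzoTwo.X₂ ∧
    ∀ γ : GaloisField 3 2, γ ^ 2 = γ + 1 →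
      DelPezzoTwo.IsUnirational (GaloisField 3 2) 2 (DelPezzoTwo.X₃ γ) := by
  exact ⟨DelPezzoTwo.isUnirational_X₁, DelPezzoTwo.isUnirational_X₂,
    fun _ hγ => DelPezzoTwo.isUnirational_X₃ hγ⟩
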